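/- **Proposition 6.1.** For $z$ in the upper half-plane $\mathbb H$ put $q=e^{2\pi i z}$ and let $\eta(z)=q^{1/24}\prod_{n\ge 1}(1-q^n)$ (with $q^{1/24}=e^{2\pi i z/24}$) be the Dedekind eta function. An *eta quotient* is a function of the form $f(z)=\prod_{\delta\mid N}\eta(\delta z)^{r_\delta}$ on $\mathbb H$, for some integer $N\ge 1$ and some integers $r_\delta$ $(\delta\mid N)$. For an integer $D\ge 1$ let $\left(\frac{-D}{\cdot}\right)$ be the Kronecker symbol and let $S_1\left(\Gamma_0(D),\left(\frac{-D}{\cdot}\right)\right)$ be the space of cusp forms $f$ of weight $1$ for $\Gamma_1(D)$ such that $$f\left(\frac{az+b}{cz+d}\right)=\left(\frac{-D}{d}\right)(cz+d)\,f(z)\qquad\text{for all }\begin{pmatrix}a&b\\c&d\end{pmatrix}\in\Gamma_0(D),\ z\in\mathbb H.$$ Let $D$ be a prime and let $f\in S_1\left(\Gamma_0(D),\left(\frac{-D}{\cdot}\right)\right)$ be an eta quotient (of any level $N$). Then $D\equiv 23\pmod{24}$ and, for all $z\in\mathbb H$, $$f(z)=\eta(z)\,\eta(Dz)=q^{\frac{D+1}{24}}\prod_{n=1}^\infty(1-q^n)^{c(n)},\qquad\text{where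 } c(n)=\begin{cases}2&\text{if } D\mid n,\\1&\text{otherwise,}\end{cases}$$ and the infinite product converges. -/

import Mathlib

open UpperHalfPlane ModularForm
open scoped MatrixGroups

/-- The Kronecker symbol `(a / n)` for arbitrary integers `a` and `n`: it is completely
multiplicative in `n`, extends the Jacobi symbol for odd positive `n`, and
* `(a / 2)` is `0` for even `a`, `1` for `a ≡ ±1 mod 8`, `-1` for `a ≡ ±3 mod 8`
  (these are the values of `ZMod.χ₈`);
* `(a / -1)` is `-1` for `a < 0` and `1` for `a ≥ 0`;
* `(a / 0)` is `1` for `a = ±1` and `0` otherwise. -/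
def kroneckerSymbol (a n : ℤ) : ℤ :=
  if n = 0 then (if a = 1 ∨ a = -1 then 1 else 0)
  else (if a < 0 ∧ n < 0 then -1 else 1)
    * ZMod.χ₈ (a : ZMod 8) ^ n.natAbs.factorization 2
    * jacobiSym a (n.natAbs / 2 ^ n.natAbs.factorization 2)

/-- The space `S_k(Γ₀(N), χ)`: the cusp forms `f` of weight `k` for `Γ₁(N)` with
`f((az+b)/(cz+d)) = χ(d) (cz+d)^k f(z)` for all matrices `(a, b; c, d)` in `Γ₀(N)`. -/
noncomputable def cuspFormsWithCharacter (k : ℤ) (N : ℕ) (χ : ℤ → ℂ) :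
    Submodule ℂ (CuspForm (CongruenceSubgroup.Gamma1 N) k) where
  carrier := {f | ∀ γ : SL(2, ℤ), γ ∈ CongruenceSubgroup.Gamma0 N →
    (f : ℍ → ℂ) ∣[k] γ = χ (γ 1 1) • (f : ℍ → ℂ)}
  zero_mem' := by
    intro γ _
    simp
  add_mem' := by
    intro f g hf hg γ hγ
    simp [hf γ hγ, hg γ hγ]
  smul_mem' := by
    intro c f hf γ hγ
    have h : (f : ℍ → ℂ) ∣[k] γ = χ (γ 1 1) • (f : ℍ → ℂ) := hf γ hγ
    change (c • (f : ℍ → ℂ)) ∣[k] γ = χ (γ 1 1) • (c • (f : ℍ → ℂ))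
    rw [ModularForm.SL_smul_slash, h, smul_comm]

/-- An eta quotient: a function `z ↦ ∏_{δ ∣ N} η(δ z)^{r_δ}` on the upper half-plane, for some
level `N ≥ 1` and some integer exponents `r_δ`. -/
def IsEtaQuotient (f : ℍ → ℂ) : Prop :=
  ∃ N : ℕ, 1 ≤ N ∧ ∃ r : ℕ → ℤ,
    ∀ z : ℍ, f z = ∏ δ ∈ N.divisors, ModularForm.eta ((δ : ℂ) * (z : ℂ)) ^ r δ

/-! An eta quotient has no zeros on the upper half-plane, so all zeros of `f` sit at the two cusps
of `Γ₀(D)`. Let `m, n ≥ 1` be its orders at `∞` and `0`, in the local parameters `q` and `q^(1/D)`.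
Dividing `f^(12(D-1))` by suitable powers of `η(z)^24` and `η(Dz)^24` gives a zero-free,
`Γ₀(D)`-invariant function of order `0` at `∞`. It or its inverse is bounded at both cusps, hence
constant; its order at `0` then vanishes too, which gives `D + 1 = 12(m + n)`
(`exists_prod_eq_const`). The functions `η(δz)` are multiplicatively independent modulo constants
(`eta_exponents_eq_zero`), so exponents can be compared: `(D-1) r₁ = 2(12n-1)`. Positivity of `m`
and `n` puts `r₁` strictly between `0` and `2`. Thus `r₁ = 1`, which forces `m = n`, `D + 1 = 24m`
and `f = η(z)η(Dz)`. -/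

open Filter Topology Function
open scoped Manifold

/-! ### Orders at the cusp `i∞` -/

/-- `g` behaves at `i∞` like a nonzero multiple of the `n`-th power of `e ^ (2πiz/h)`. -/
def HasOrderAtImInfty (h : ℝ) (g : ℍ → ℂ) (n : ℤ) : Prop :=
  ∃ C : ℂ, C ≠ 0 ∧
    Tendsto (fun z : ℍ => g z * Periodic.qParam h (z : ℂ) ^ (-n)) atImInfty (𝓝 C)

namespace HasOrderAtImInfty

variable {h : ℝ} {g g' : ℍ → ℂ} {n n' : ℤ}

lemma mul (hg : HasOrderAtImInfty h g n) (hg' : HasOrderAtImInfty h g' n') :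
    HasOrderAtImInfty h (fun z => g z * g' z) (n + n') := by
  obtain ⟨C, hC, hT⟩ := hg
  obtain ⟨C', hC', hT'⟩ := hg'
  refine ⟨C * C', mul_ne_zero hC hC', (hT.mul hT').congr fun z => ?_⟩
  rw [neg_add, zpow_add₀ (Periodic.qParam_ne_zero _)]
  ring

lemma zpow (hg : HasOrderAtImInfty h g n) (k : ℤ) :
    HasOrderAtImInfty h (fun z => g z ^ k) (n * k) := by
  obtain ⟨C, hC, hT⟩ := hg
  refine ⟨C ^ k, zpow_ne_zero _ hC, (hT.zpow₀ k (.inl hC)).congr fun z => ?_⟩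
  rw [mul_zpow, ← zpow_mul, neg_mul]

lemma const {c : ℂ} (hc : c ≠ 0) : HasOrderAtImInfty h (fun _ => c) 0 :=
  ⟨c, hc, by simp⟩

/-- Brings functions with different periods to one local parameter, since `q_h = q_{kh}^k`. -/
lemma of_width_mul (hg : HasOrderAtImInfty h g n) {k : ℕ} (hk : k ≠ 0) :
    HasOrderAtImInfty (k * h) g (k * n) := by
  obtain ⟨C, hC, hT⟩ := hg
  refine ⟨C, hC, hT.congr fun z => ?_⟩
  have : Periodic.qParam h (z : ℂ) = Periodic.qParam (k * h) (z : ℂ) ^ (k : ℤ) := by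
    simp only [Periodic.qParam, zpow_natCast, ← Complex.exp_nat_mul]
    congr 1
    have : (k : ℂ) ≠ 0 := mod_cast hk
    push_cast
    field_simp
  rw [this, ← zpow_mul, mul_neg]

lemma isZeroAtImInfty (hh : 0 < h) (hg : HasOrderAtImInfty h g n) (hn : 0 < n) :
    IsZeroAtImInfty g := by
  obtain ⟨C, hC, hT⟩ := hg
  have := hT.mul (((qParam_tendsto_atImInfty hh).pow n.toNat))
  rw [zero_pow (by lia), mul_zero] at this
  refine this.congr fun z => ?_
  rw [← zpow_natCast, mul_assoc, ← zpow_add₀ (Periodic.qParam_ne_zero _)]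
  simp [hn.le]

lemma isBoundedAtImInfty (hh : 0 < h) (hg : HasOrderAtImInfty h g n) (hn : 0 ≤ n) :
    IsBoundedAtImInfty g := by
  rcases hn.eq_or_lt with rfl | hn
  · obtain ⟨C, hC, hT⟩ := hg
    simp only [neg_zero, zpow_zero, mul_one] at hT
    exact hT.isBigO_one ℝ
  · exact (hg.isZeroAtImInfty hh hn).isBoundedAtImInfty

lemma eq_zero_of_const (hh : 0 < h) {c : ℂ} (hg : HasOrderAtImInfty h (fun _ => c) n) :
    n = 0 := by
  have hc : c ≠ 0 := by
    rintro rfl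
    obtain ⟨C, hC, hT⟩ := hg
    simp only [zero_mul] at hT
    exact hC (tendsto_nhds_unique hT tendsto_const_nhds)
  have key : ∀ {c : ℂ} {k : ℤ}, c ≠ 0 → HasOrderAtImInfty h (fun _ => c) k → ¬ 0 < k :=
    fun hc hg hk => hc (tendsto_nhds_unique tendsto_const_nhds (hg.isZeroAtImInfty hh hk))
  have h1 := key hc hg
  have h2 := key (zpow_ne_zero (-1) hc) (hg.zpow (-1))
  lia

/-- A nonvanishing, holomorphic and periodic function that tends to zero at `i∞` has a positive
order there. -/
lemma exists_of_periodic (hh : 0 < h) (hper : ∀ z : ℍ, g (h +ᵥ z) = g z) (hhol : MDiff g)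
    (hz : IsZeroAtImInfty g) (hne : ∀ z, g z ≠ 0) : ∃ n : ℤ, 0 < n ∧ HasOrderAtImInfty h g n := by
  have hper' : Periodic (g ∘ ofComplex) h := by
    intro w
    by_cases! hw : 0 < w.im
    · have hw' : 0 < (w + h).im := by simp [hw]
      simp only [comp_apply, ofComplex_apply_of_im_pos hw', ofComplex_apply_of_im_pos hw]
      rw [← hper ⟨w, hw⟩]
      congr 1
      ext
      simp [add_comm]
    · have hw' : (w + h).im ≤ 0 := by simpa using hw
      simp [ofComplex_apply_of_im_nonpos hw', ofComplex_apply_of_im_nonpos hw]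
  have han := analyticAt_cuspFunction_zero hh hper' hhol hz.isBoundedAtImInfty
  have hq : Tendsto (fun z : ℍ => Periodic.qParam h (z : ℂ)) atImInfty (𝓝[≠] 0) :=
    (Periodic.qParam_tendsto hh).comp tendsto_coe_atImInfty
  have hval (z : ℍ) := eq_cuspFunction z hh.ne' hper'
  -- Vanishing near `q = 0` would give zeros of `g` high in the half-plane.
  have hnz : ¬ ∀ᶠ q in 𝓝 0, cuspFunction h g q = 0 := fun hev => by
    obtain ⟨z, hz⟩ := (hq.eventually (hev.filter_mono nhdsWithin_le_nhds)).exists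
    exact hne z (by rw [← hval z, hz])
  obtain ⟨n, u, hu, hu0, hev⟩ := han.exists_eventuallyEq_pow_smul_nonzero_iff.mpr hnz
  have hord : HasOrderAtImInfty h g n := by
    refine ⟨u 0, hu0, ((hu.continuousAt.tendsto.mono_left nhdsWithin_le_nhds).comp hq).congr' ?_⟩
    filter_upwards [hq.eventually (hev.filter_mono nhdsWithin_le_nhds)] with z hz
    rw [← hval z, hz, zpow_neg, zpow_natCast]
    simp [Periodic.qParam_ne_zero, mul_comm]
  refine ⟨n, ?_, hord⟩
  by_contra! hn
  obtain rfl : n = 0 := by lia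
  obtain ⟨C, hC, hT⟩ := hord
  simp only [Nat.cast_zero, neg_zero, zpow_zero, mul_one] at hT
  exact hC (tendsto_nhds_unique hT hz)

end HasOrderAtImInfty

/-! ### Expansion of eta at `i∞` and multiplicative independence -/

lemma tendsto_tprod_one_sub_pow :
    Tendsto (fun q : ℂ => ∏' n : ℕ, (1 - q ^ (n + 1))) (𝓝 0) (𝓝 1) := by
  have h := (differentiableOn_tprod_one_sub_pow.differentiableAt
    (Metric.ball_mem_nhds (0 : ℂ) one_pos)).continuousAt.tendsto
  simpa using h

/-- The order of `z ↦ η(tz)` at `i∞`. -/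
lemma hasOrderAtImInfty_eta_comp_mul {t : ℝ} (ht : 0 < t) :
    HasOrderAtImInfty (24 / t) (fun z => eta (t * z)) 1 := by
  refine ⟨1, one_ne_zero, ?_⟩
  have h1 : (0 : ℝ) < 1 / t := by positivity
  refine (tendsto_tprod_one_sub_pow.comp (qParam_tendsto_atImInfty h1)).congr fun z => ?_
  have ht' : (t : ℂ) ≠ 0 := mod_cast ht.ne'
  have e24 : Periodic.qParam 24 (t * z) = Periodic.qParam (24 / t) z := by
    simp only [Periodic.qParam]
    congr 1
    push_cast
    field_simp
  have e1 : Periodic.qParam 1 (t * z) = Periodic.qParam (1 / t) z := by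
    simp only [Periodic.qParam]
    congr 1
    push_cast
    field_simp
  simp only [eta, eta_q, comp_apply, e24, e1]
  field_simp [Periodic.qParam_ne_zero]

/-- The Euler product `∏ (1 - q ^ (n + 1))` has derivative `-1` at the origin. -/
lemma hasDerivAt_tprod_one_sub_pow_zero :
    HasDerivAt (fun q : ℂ => ∏' n : ℕ, (1 - q ^ (n + 1))) (-1) 0 := by
  have hd := differentiableOn_tprod_one_sub_pow.differentiableAt
    (Metric.ball_mem_nhds (0 : ℂ) one_pos)
  -- At the origin only the factor `1 - q` has a nonzero logarithmic derivative.
  have hlog (i : ℕ) : logDeriv (fun q : ℂ => 1 - q ^ (i + 1)) 0 = if i = 0 then -1 else 0 := by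
    rw [logDeriv_apply]
    rcases eq_or_ne i 0 with rfl | hi
    · simp
    · simp [hi]
  have h := logDeriv_tprod_eq_tsum (f := fun (n : ℕ) (q : ℂ) => 1 - q ^ (n + 1))
    Metric.isOpen_ball (Metric.mem_ball_self one_pos) (fun i => by simp) (fun i => by fun_prop)
    (by simpa only [hlog] using (hasSum_ite_eq 0 (-1 : ℂ)).summable)
    multipliableLocallyUniformlyOn_one_sub_pow (by simp)
  simp only [hlog, tsum_ite_eq, logDeriv_apply] at h
  simp only [ne_eq, Nat.add_eq_zero_iff, one_ne_zero, and_false, not_false_eq_true, zero_pow,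
    sub_zero, tprod_one, div_one] at h
  exact h ▸ hd.hasDerivAt

/-- `g` has an expansion `1 + c q ^ k + o(q ^ k)` at the origin. -/
def HasUnitExpansion (k : ℕ) (g : ℂ → ℂ) (c : ℂ) : Prop :=
  Tendsto g (𝓝[≠] 0) (𝓝 1) ∧ Tendsto (fun q => (g q - 1) / q ^ k) (𝓝[≠] 0) (𝓝 c)

/-- Leading coefficients add because `gh - 1 = (g - 1)h + (h - 1)`. -/
lemma HasUnitExpansion.prod {ι : Type*} {k : ℕ} {g : ι → ℂ → ℂ} {c : ι → ℂ} (S : Finset ι)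
    (h : ∀ i ∈ S, HasUnitExpansion k (g i) (c i)) :
    HasUnitExpansion k (fun q => ∏ i ∈ S, g i q) (∑ i ∈ S, c i) := by
  classical
  induction S using Finset.induction_on with
  | empty => simp [HasUnitExpansion]
  | insert i S hi ih =>
    obtain ⟨h1, h2⟩ := h i (Finset.mem_insert_self i S)
    obtain ⟨h3, h4⟩ := ih fun j hj => h j (Finset.mem_insert_of_mem hj)
    simp only [Finset.prod_insert hi, Finset.sum_insert hi]
    refine ⟨by simpa using h1.mul h3, ?_⟩
    have := (h2.mul h3).add h4
    rw [mul_one] at this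
    exact this.congr fun q => by ring

/-- The product is `1 - s q^δ + o(q^δ)`, so for `δ > k` it is invisible at order `q^k`. -/
lemma hasUnitExpansion_eulerProd_zpow {k δ : ℕ} (hk : k ≠ 0) (hkδ : k ≤ δ) (s : ℤ) :
    HasUnitExpansion k (fun q => (∏' n : ℕ, (1 - (q ^ δ) ^ (n + 1))) ^ s)
      (if δ = k then -(s : ℂ) else 0) := by
  have hδ : δ ≠ 0 := by lia
  have hpow : Tendsto (fun q : ℂ => q ^ δ) (𝓝[≠] 0) (𝓝[≠] 0) := by
    refine tendsto_nhdsWithin_of_tendsto_nhds_of_eventually_within _ ?_ ?_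
    · simpa [hδ] using ((continuous_pow δ).tendsto (0 : ℂ)).mono_left nhdsWithin_le_nhds
    · filter_upwards [self_mem_nhdsWithin] with q hq
      exact pow_ne_zero δ hq
  have hder : HasDerivAt (fun y : ℂ => (∏' n : ℕ, (1 - y ^ (n + 1))) ^ s) (-s) 0 := by
    have := (hasDerivAt_zpow s (∏' n : ℕ, (1 - (0 : ℂ) ^ (n + 1))) (.inl (by simp))).comp (0 : ℂ)
      hasDerivAt_tprod_one_sub_pow_zero
    simpa [comp_def] using! this
  refine ⟨?_, ?_⟩
  · have := (hder.continuousAt.tendsto.mono_left nhdsWithin_le_nhds).comp hpow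
    simpa [comp_def] using this
  · have h1 := (hasDerivAt_iff_tendsto_slope.mp hder).comp hpow
    have h2 : Tendsto (fun q : ℂ => q ^ (δ - k)) (𝓝[≠] 0) (𝓝 (0 ^ (δ - k))) :=
      ((continuous_pow _).tendsto (0 : ℂ)).mono_left nhdsWithin_le_nhds
    have h3 := h1.mul h2
    have hc : (-s * 0 ^ (δ - k) : ℂ) = if δ = k then -(s : ℂ) else 0 := by
      rcases eq_or_ne δ k with rfl | hne
      · simp
      · simp [hne, show δ - k ≠ 0 by lia]
    rw [hc] at h3
    refine h3.congr' ?_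
    filter_upwards [self_mem_nhdsWithin] with q (hq : q ≠ 0)
    have : q ^ δ = q ^ k * q ^ (δ - k) := by rw [← pow_add]; congr 1; lia
    simp only [comp_apply, slope_def_field, sub_zero]
    simp only [ne_eq, Nat.add_eq_zero_iff, one_ne_zero, and_false, not_false_eq_true, zero_pow,
      sub_zero, tprod_one, one_zpow]
    rw [div_mul_eq_mul_div, div_eq_div_iff (pow_ne_zero _ hq) (pow_ne_zero _ hq)]
    rw [this]
    ring

lemma eta_natCast_mul (δ : ℕ) (z : ℂ) :
    eta (δ * z) = Periodic.qParam 24 z ^ δ *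
      ∏' n : ℕ, (1 - (Periodic.qParam 1 z ^ δ) ^ (n + 1)) := by
  have (h : ℝ) : Periodic.qParam h (δ * z) = Periodic.qParam h z ^ δ := by
    simp only [Periodic.qParam, ← Complex.exp_nat_mul]
    congr 1
    ring
  simp only [eta, eta_q, this]

lemma zpow_sum₀ {ι K : Type*} [Field K] {x : K} (hx : x ≠ 0) (S : Finset ι) (n : ι → ℤ) :
    x ^ ∑ i ∈ S, n i = ∏ i ∈ S, x ^ n i := by
  classical
  induction S using Finset.induction_on with
  | empty => simp
  | insert i S hi ih => rw [Finset.sum_insert hi, Finset.prod_insert hi, zpow_add₀ hx, ih]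

/-- The functions `z ↦ η(δz)` are multiplicatively independent, even modulo constants. -/
theorem eta_exponents_eq_zero {S : Finset ℕ} (hS : 0 ∉ S) {s : ℕ → ℤ} {c : ℂ}
    (h : ∀ z : ℍ, ∏ δ ∈ S, eta ((δ : ℂ) * (z : ℂ)) ^ s δ = c) : ∀ δ ∈ S, s δ = 0 := by
  by_contra! hex
  set T := S.filter (fun δ => s δ ≠ 0) with hT
  have hTne : T.Nonempty := by
    obtain ⟨δ, h1, h2⟩ := hex
    exact ⟨δ, by simp [hT, h1, h2]⟩
  have hprodT (z : ℍ) : ∏ δ ∈ T, eta ((δ : ℂ) * (z : ℂ)) ^ s δ = c := by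
    rw [← h z, hT, Finset.prod_filter]
    refine Finset.prod_congr rfl fun δ _ => ?_
    by_cases hs : s δ = 0 <;> simp [hs]
  obtain ⟨hkT, hmin⟩ := T.isLeast_min' hTne
  -- For the least `δ = k` with nonzero exponent, the Euler part is `1 - s_k q^k + o(q^k)`; being
  -- constant, it forces `s_k = 0`.
  set k := T.min' hTne
  have hk : k ≠ 0 := fun h0 => hS (h0 ▸ (Finset.mem_filter.mp hkT).1)
  have hexp := HasUnitExpansion.prod T (g := fun δ q => (∏' n : ℕ, (1 - (q ^ δ) ^ (n + 1))) ^ s δ)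
    (fun δ hδ => hasUnitExpansion_eulerProd_zpow hk (hmin hδ) (s δ))
  rw [Finset.sum_ite_eq' T k, if_pos (Finset.mem_coe.mp hkT)] at hexp
  set G : ℂ → ℂ := fun q => ∏ δ ∈ T, (∏' n : ℕ, (1 - (q ^ δ) ^ (n + 1))) ^ s δ with hG
  set E : ℤ := ∑ δ ∈ T, δ * s δ with hE
  have hfac (z : ℍ) : Periodic.qParam 24 (z : ℂ) ^ E * G (Periodic.qParam 1 (z : ℂ)) = c := by
    rw [← hprodT z]
    simp only [eta_natCast_mul, mul_zpow, Finset.prod_mul_distrib, hG, hE]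
    congr 1
    rw [zpow_sum₀ (Periodic.qParam_ne_zero _)]
    exact Finset.prod_congr rfl fun δ _ => by rw [zpow_mul, zpow_natCast]
  have hq : Tendsto (fun z : ℍ => Periodic.qParam 1 (z : ℂ)) atImInfty (𝓝[≠] 0) :=
    (Periodic.qParam_tendsto one_pos).comp tendsto_coe_atImInfty
  have hE0 : E = 0 := by
    refine HasOrderAtImInfty.eq_zero_of_const (h := 24) (by norm_num) (c := c)
      ⟨1, one_ne_zero, (hexp.1.comp hq).congr fun z => ?_⟩
    rw [← hfac z, mul_comm, ← mul_assoc, ← zpow_add₀ (Periodic.qParam_ne_zero _)]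
    simp
  simp only [hE0, zpow_zero, one_mul] at hfac
  have hc : c = 1 := tendsto_nhds_unique tendsto_const_nhds ((hexp.1.comp hq).congr hfac)
  have h0 : Tendsto (fun _ : ℍ => (0 : ℂ)) atImInfty (𝓝 (-s k)) :=
    (hexp.2.comp hq).congr fun z => by simp [hfac z, hc]
  have := tendsto_nhds_unique h0 tendsto_const_nhds
  exact (Finset.mem_filter.mp hkT).2 (by simpa using this)

/-! ### Functions invariant under `Γ₀(D)` -/

lemma exists_mem_Gamma0_mul_S_mul_T {D : ℕ} (hD : D.Prime) (γ : SL(2, ℤ))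
    (hγ : γ ∉ CongruenceSubgroup.Gamma0 D) :
    ∃ g ∈ CongruenceSubgroup.Gamma0 D, ∃ j : ℤ,
      γ = g * (ModularGroup.S * ModularGroup.T ^ j) := by
  have : Fact D.Prime := ⟨hD⟩
  rw [CongruenceSubgroup.Gamma0_mem] at hγ
  obtain ⟨j, hj⟩ : ∃ j : ℤ, ((γ 1 1 - j * γ 1 0 : ℤ) : ZMod D) = 0 := by
    -- As `D` is prime, the lower-left entry is invertible mod `D`; `j` is the quotient of the
    -- bottom row.
    refine ⟨((γ 1 1 : ZMod D) / (γ 1 0 : ZMod D)).val, ?_⟩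
    push_cast
    rw [ZMod.natCast_zmod_val, div_mul_cancel₀ _ hγ, sub_self]
  refine ⟨γ * (ModularGroup.S * ModularGroup.T ^ j)⁻¹, ?_, j, by group⟩
  rw [CongruenceSubgroup.Gamma0_mem]
  have h10 : (γ * (ModularGroup.S * ModularGroup.T ^ j)⁻¹) 1 0 = -(γ 1 1 - j * γ 1 0) := by
    have hS : ((ModularGroup.S⁻¹ : SL(2, ℤ)) : Matrix (Fin 2) (Fin 2) ℤ) = !![0, 1; -1, 0] := by
      rw [Matrix.SpecialLinearGroup.coe_inv, ModularGroup.coe_S, Matrix.adjugate_fin_two_of]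
      simp
    rw [mul_inv_rev, ← zpow_neg, Matrix.SpecialLinearGroup.coe_mul,
      Matrix.SpecialLinearGroup.coe_mul, hS, ModularGroup.coe_T_zpow]
    simp [Matrix.mul_apply, Fin.sum_univ_two]
    ring
  rw [h10, Int.cast_neg, hj, neg_zero]

/-- A function on the upper half-plane that is invariant under `Γ₀(D)`, for a prime `D`, and
bounded at the two cusps `∞` and `0`, is constant. -/
theorem exists_eq_const_of_Gamma0_invariant {D : ℕ} (hD : D.Prime) {F : ℍ → ℂ} (hhol : MDiff F)
    (hinv : ∀ γ ∈ CongruenceSubgroup.Gamma0 D, ∀ z : ℍ, F (γ • z) = F z)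
    (hinfty : IsBoundedAtImInfty F)
    (hzero : IsBoundedAtImInfty fun z => F (ModularGroup.S • z)) : ∃ c, ∀ z, F z = c := by
  have : NeZero D := ⟨hD.ne_zero⟩
  have hslash (γ : SL(2, ℤ)) : F ∣[(0 : ℤ)] γ = fun z => F (γ • z) := by
    ext z
    simp [SL_slash_apply]
  let G : ModularForm (CongruenceSubgroup.Gamma0 D : Subgroup (GL (Fin 2) ℝ)) 0 :=
    { toFun := F
      holo' := hhol
      slash_action_eq' := by
        rintro _ ⟨γ, hγ, rfl⟩
        exact (hslash γ).trans (funext (hinv γ hγ))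
      bdd_at_cusps' := by
        intro c hc
        rw [Subgroup.IsArithmetic.isCusp_iff_isCusp_SL2Z] at hc
        rw [OnePoint.isBoundedAt_iff_forall_SL2Z hc]
        intro γ _
        rw [hslash]
        by_cases hγ : γ ∈ CongruenceSubgroup.Gamma0 D
        · simpa only [hinv γ hγ] using hinfty
        · obtain ⟨g, hg, j, rfl⟩ := exists_mem_Gamma0_mul_S_mul_T hD γ hγ
          simp only [mul_smul, hinv g hg]
          rw [isBoundedAtImInfty_iff] at hzero ⊢
          obtain ⟨M, A, hM⟩ := hzero
          refine ⟨M, A, fun z hz => hM _ ?_⟩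
          rw [modular_T_zpow_smul]
          simpa using hz }
  obtain ⟨c, hc⟩ := ModularForm.eq_const_of_weight_zero G
  exact ⟨c, fun z => congrFun hc z⟩

/-! ### Transformation of eta powers, and auxiliary product identities -/

lemma discriminant_smul (γ : SL(2, ℤ)) (z : ℍ) :
    discriminant (γ • z) = denom γ z ^ (12 : ℤ) * discriminant z := by
  have := congrFun (SlashInvariantForm.slash_action_generators_SL2Z discriminant_S_invariant
    discriminant_T_invariant γ) z
  rw [SL_slash_apply] at this
  rw [← this, mul_comm, mul_assoc, ← zpow_add₀ (denom_ne_zero _ z)]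
  simp

lemma eta_pow_eq_discriminant {w : ℂ} {z : ℍ} (h : w = z) : eta w ^ 24 = discriminant z := by
  rw [h, discriminant]

lemma eta_natCast_mul_smul_pow {D : ℕ} (hD : 0 < D) {γ : SL(2, ℤ)}
    (hγ : γ ∈ CongruenceSubgroup.Gamma0 D) (z : ℍ) :
    eta (D * ((γ • z : ℍ) : ℂ)) ^ 24 = denom γ z ^ (12 : ℤ) * eta (D * (z : ℂ)) ^ 24 := by
  have hDR : (0 : ℝ) < D := mod_cast hD
  obtain ⟨c, hc⟩ : (D : ℤ) ∣ γ 1 0 := by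
    rwa [CongruenceSubgroup.Gamma0_mem, ZMod.intCast_zmod_eq_zero_iff_dvd] at hγ
  have hdet : γ 0 0 * γ 1 1 - γ 0 1 * γ 1 0 = 1 := by
    rw [← Matrix.det_fin_two, γ.det_coe]
  -- The conjugate of `γ` by `diag(D, 1)`, integral because `D` divides the lower-left entry.
  let γ' : SL(2, ℤ) := ⟨!![γ 0 0, γ 0 1 * D; c, γ 1 1], by
    rw [hc] at hdet
    rw [Matrix.det_fin_two_of]
    linarith⟩
  let w : ℍ := (⟨D, hDR⟩ : {x : ℝ // 0 < x}) • z
  have hw : (w : ℂ) = D * z := by simp [w]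
  have hden : denom γ' w = denom γ z := by
    rw [ModularGroup.denom_apply, ModularGroup.denom_apply, hw]
    simp [γ', hc]
    ring
  have hsmul : ((γ' • w : ℍ) : ℂ) = D * ((γ • z : ℍ) : ℂ) := by
    have h1 := ModularGroup.denom_apply γ' w
    have h2 := ModularGroup.denom_apply γ z
    rw [coe_specialLinearGroup_apply, coe_specialLinearGroup_apply]
    simp only [algebraMap_int_eq, eq_intCast, Complex.ofReal_intCast]
    rw [← h1, ← h2, hden, hw]
    simp [γ']
    ring
  rw [eta_pow_eq_discriminant hsmul.symm, eta_pow_eq_discriminant hw.symm, discriminant_smul, hden]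

/-- Inversion at `z/D`, since `D · (-1/z) = -1/(z/D)`. -/
lemma eta_natCast_mul_S_smul_pow {D : ℕ} (hD : 0 < D) (z : ℍ) :
    eta (D * ((ModularGroup.S • z : ℍ) : ℂ)) ^ 24 =
      ((z : ℂ) / D) ^ (12 : ℤ) * eta ((1 / D : ℝ) * (z : ℂ)) ^ 24 := by
  have hDR : (0 : ℝ) < D := mod_cast hD
  let w : ℍ := (⟨1 / D, by positivity⟩ : {x : ℝ // 0 < x}) • z
  have hw : (w : ℂ) = (1 / D : ℝ) * z := by simp [w]
  have hS : ((ModularGroup.S • w : ℍ) : ℂ) = D * ((ModularGroup.S • z : ℍ) : ℂ) := by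
    have := z.ne_zero
    have : (D : ℂ) ≠ 0 := mod_cast hD.ne'
    simp only [modular_S_smul, hw]
    push_cast
    field_simp
  rw [eta_pow_eq_discriminant hS.symm, eta_pow_eq_discriminant hw.symm, discriminant_smul,
    ModularGroup.denom_S, hw]
  push_cast
  congr 2
  ring

lemma mdifferentiable_eta_mul {t : ℝ} (ht : 0 < t) : MDiff fun z : ℍ => eta (t * (z : ℂ)) := by
  rw [mdifferentiable_iff]
  refine DifferentiableOn.congr (f := fun z => eta (t * z)) (fun z hz => ?_) fun z hz => ?_
  · refine (DifferentiableAt.comp z (differentiableAt_eta_of_mem_upperHalfPlaneSet ?_)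
      (by fun_prop)).differentiableWithinAt
    have : 0 < z.im := hz
    simpa [upperHalfPlaneSet] using mul_pos ht this
  · simp [ofComplex_apply_of_im_pos hz]

lemma MDifferentiable.zpow_of_ne_zero {g : ℍ → ℂ} (hg : MDiff g) (hne : ∀ z, g z ≠ 0) (n : ℤ) :
    MDiff fun z => g z ^ n := by
  rw [mdifferentiable_iff] at hg ⊢
  intro z hz
  exact (hg z hz).zpow (.inl (hne _))

lemma kroneckerSymbol_sq_of_ne_zero {a n : ℤ} (h : kroneckerSymbol a n ≠ 0) :
    kroneckerSymbol a n ^ 2 = 1 := by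
  have key : kroneckerSymbol a n = 0 ∨ kroneckerSymbol a n = 1 ∨ kroneckerSymbol a n = -1 := by
    have hχ : ∀ x : ZMod 8, ZMod.χ₈ x = 0 ∨ ZMod.χ₈ x = 1 ∨ ZMod.χ₈ x = -1 := by decide
    have hpow (x : ℤ) (k : ℕ) (hx : x = 0 ∨ x = 1 ∨ x = -1) :
        x ^ k = 0 ∨ x ^ k = 1 ∨ x ^ k = -1 := by
      rcases hx with rfl | rfl | rfl
      · rcases eq_or_ne k 0 with rfl | hk <;> simp [*]
      · simp
      · right; exact neg_one_pow_eq_or ℤ k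
    have hmul (x y : ℤ) (hx : x = 0 ∨ x = 1 ∨ x = -1) (hy : y = 0 ∨ y = 1 ∨ y = -1) :
        x * y = 0 ∨ x * y = 1 ∨ x * y = -1 := by
      rcases hx with rfl | rfl | rfl <;> rcases hy with rfl | rfl | rfl <;> simp
    unfold kroneckerSymbol
    split_ifs
    · simp
    · simp
    · exact hmul _ _ (hmul _ _ (by simp) (hpow _ _ (hχ _))) (jacobiSym.trichotomy _ _)
    · exact hmul _ _ (hmul _ _ (by simp) (hpow _ _ (hχ _))) (jacobiSym.trichotomy _ _)
  rcases key with h0 | h1 | h1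
  · exact absurd h0 h
  · simp [h1]
  · simp [h1]

lemma hasProd_pnat_one_sub_pow {q : ℂ} (hq : ‖q‖ < 1) :
    HasProd (fun n : ℕ+ => 1 - q ^ (n : ℕ)) (∏' n : ℕ, (1 - q ^ (n + 1))) := by
  rw [← Equiv.pnatEquivNat.symm.hasProd_iff]
  simpa [comp_def] using (multipliable_one_sub_pow hq).hasProd

lemma hasProd_pnat_one_sub_pow_ite {q : ℂ} (hq : ‖q‖ < 1) {D : ℕ} (hD : 0 < D) :
    HasProd (fun n : ℕ+ => (1 - q ^ (n : ℕ)) ^ (if D ∣ (n : ℕ) then 2 else 1 : ℕ))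
      ((∏' n : ℕ, (1 - q ^ (n + 1))) * ∏' n : ℕ, (1 - (q ^ D) ^ (n + 1))) := by
  have hqD : ‖q ^ D‖ < 1 := by
    rw [norm_pow]
    exact pow_lt_one₀ (norm_nonneg _) hq hD.ne'
  have hinj : Injective fun n : ℕ+ => D.toPNat hD * n := mul_right_injective _
  have h2 : HasProd (fun n : ℕ+ => if D ∣ (n : ℕ) then 1 - q ^ (n : ℕ) else 1)
      (∏' n : ℕ, (1 - (q ^ D) ^ (n + 1))) := by
    rw [← hinj.hasProd_iff]
    · refine (hasProd_pnat_one_sub_pow hqD).congr_fun fun n => ?_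
      have hcoe : ((D.toPNat hD * n : ℕ+) : ℕ) = D * n := rfl
      rw [comp_apply, hcoe, if_pos (dvd_mul_right _ _), pow_mul]
    · intro n hn
      rw [if_neg]
      rintro ⟨k, hk⟩
      have hk0 : 0 < k := Nat.pos_of_ne_zero fun h0 => n.pos.ne' (by rw [hk, h0, mul_zero])
      exact hn ⟨⟨k, hk0⟩, PNat.eq hk.symm⟩
  refine ((hasProd_pnat_one_sub_pow hq).mul h2).congr_fun fun n => ?_
  split_ifs <;> ring

/-- Collects a relation between `f`, `η(z)` and `η(Dz)` into one product over `S`, with `r` extended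
by zero since `D` need not divide `N`. -/
lemma prod_zpow_sub_ite {T S : Finset ℕ} (hTS : T ⊆ S) {D : ℕ} (h1 : 1 ∈ S) (hD : D ∈ S)
    {x : ℕ → ℂ} (hx : ∀ δ ∈ S, x δ ≠ 0) (r : ℕ → ℤ) (M A B : ℤ) :
    ∏ δ ∈ S, x δ ^ (M * (if δ ∈ T then r δ else 0) - (if δ = 1 then A else 0)
      - (if δ = D then B else 0)) = (∏ δ ∈ T, x δ ^ r δ) ^ M * x 1 ^ (-A) * x D ^ (-B) := by
  have hsplit : ∀ δ ∈ S, x δ ^ (M * (if δ ∈ T then r δ else 0) - (if δ = 1 then A else 0)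
      - (if δ = D then B else 0)) = (if δ ∈ T then (x δ ^ r δ) ^ M else 1) *
        (if δ = 1 then x δ ^ (-A) else 1) * (if δ = D then x δ ^ (-B) else 1) := by
    intro δ hδ
    rw [sub_eq_add_neg, sub_eq_add_neg, zpow_add₀ (hx δ hδ), zpow_add₀ (hx δ hδ)]
    congr 1
    · congr 1
      · split_ifs
        · rw [← zpow_mul, mul_comm]
        · simp
      · split_ifs <;> simp
    · split_ifs <;> simp
  rw [Finset.prod_congr rfl hsplit, Finset.prod_mul_distrib, Finset.prod_mul_distrib,
    Finset.prod_ite_eq' S 1, Finset.prod_ite_eq' S D, if_pos h1, if_pos hD, ← Finset.prod_zpow,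
    Finset.prod_ite_mem, Finset.inter_eq_right.mpr hTS]

/-! ### Behaviour of cusp forms at `∞` and `0` -/

section Cusps

variable {D : ℕ} {k : ℤ}

lemma CuspForm.isZeroAtImInfty_slash_SL2Z [NeZero D]
    (f : CuspForm (CongruenceSubgroup.Gamma1 D) k) (γ : SL(2, ℤ)) :
    IsZeroAtImInfty ((f : ℍ → ℂ) ∣[k] γ) := by
  refine f.zero_at_cusps' (c := Matrix.SpecialLinearGroup.mapGL ℝ γ • OnePoint.infty) ?_ _ rfl
  rw [Subgroup.IsArithmetic.isCusp_iff_isCusp_SL2Z, isCusp_SL2Z_iff']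
  exact ⟨γ, rfl⟩

lemma slash_Gamma1 (f : CuspForm (CongruenceSubgroup.Gamma1 D) k) {γ : SL(2, ℤ)}
    (hγ : γ ∈ CongruenceSubgroup.Gamma1 D) : (f : ℍ → ℂ) ∣[k] γ = f :=
  f.slash_action_eq' _ ⟨γ, hγ, rfl⟩

lemma slash_T_zpow_apply (g : ℍ → ℂ) (j : ℤ) (z : ℍ) :
    (g ∣[k] (ModularGroup.T ^ j)) z = g ((j : ℝ) +ᵥ z) := by
  rw [SL_slash_apply, modular_T_zpow_smul, ModularGroup.denom_apply, ModularGroup.coe_T_zpow]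
  simp

lemma slash_S_apply_vadd (f : CuspForm (CongruenceSubgroup.Gamma1 D) k) (z : ℍ) :
    ((f : ℍ → ℂ) ∣[k] ModularGroup.S) ((D : ℝ) +ᵥ z) = ((f : ℍ → ℂ) ∣[k] ModularGroup.S) z := by
  -- This is `S T^D S⁻¹`; its membership in `Γ₁(D)` gives the period `D` at the cusp `0`.
  let γ : SL(2, ℤ) := ⟨!![1, 0; -D, 1], by simp⟩
  have hγ : γ ∈ CongruenceSubgroup.Gamma1 D := by
    rw [CongruenceSubgroup.Gamma1_mem]
    simp [γ]
  have hST : ModularGroup.S * ModularGroup.T ^ (D : ℤ) = γ * ModularGroup.S := by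
    ext i j
    rw [Matrix.SpecialLinearGroup.coe_mul, Matrix.SpecialLinearGroup.coe_mul,
      ModularGroup.coe_T_zpow, ModularGroup.coe_S]
    fin_cases i <;> fin_cases j <;> simp [γ, Matrix.mul_apply, Fin.sum_univ_two]
  have h := slash_T_zpow_apply (k := k) ((f : ℍ → ℂ) ∣[k] ModularGroup.S) D z
  rw [← SlashAction.slash_mul, hST, SlashAction.slash_mul, slash_Gamma1 f hγ] at h
  simpa using h.symm

lemma slash_one_apply_vadd (f : CuspForm (CongruenceSubgroup.Gamma1 D) k) (z : ℍ) :
    f ((1 : ℝ) +ᵥ z) = f z := by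
  have hT : ModularGroup.T ^ (1 : ℤ) ∈ CongruenceSubgroup.Gamma1 D := by
    rw [CongruenceSubgroup.Gamma1_mem, ModularGroup.coe_T_zpow]
    simp
  have h := slash_T_zpow_apply (k := k) f 1 z
  rw [slash_Gamma1 f hT] at h
  simpa using h.symm

/-- A nowhere vanishing cusp form for `Γ₁(D)` has positive orders at the cusps `∞` and `0`. -/
lemma CuspForm.exists_orders (hD : 0 < D) (f : CuspForm (CongruenceSubgroup.Gamma1 D) k)
    (hne : ∀ z, f z ≠ 0) : ∃ m n : ℤ, 0 < m ∧ 0 < n ∧ HasOrderAtImInfty 24 f (24 * m) ∧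
      HasOrderAtImInfty (24 * D) ((f : ℍ → ℂ) ∣[k] ModularGroup.S) (24 * n) := by
  have : NeZero D := ⟨hD.ne'⟩
  have hDR : (0 : ℝ) < D := mod_cast hD
  obtain ⟨m, hm, hfm⟩ := HasOrderAtImInfty.exists_of_periodic one_pos (slash_one_apply_vadd f)
    f.holo' (by simpa using f.isZeroAtImInfty_slash_SL2Z 1) hne
  obtain ⟨n, hn, hfn⟩ := HasOrderAtImInfty.exists_of_periodic hDR (slash_S_apply_vadd f)
    (f.holo'.slash k _) (f.isZeroAtImInfty_slash_SL2Z ModularGroup.S) fun z => by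
      rw [SL_slash_apply]
      exact mul_ne_zero (hne _) (zpow_ne_zero _ (denom_ne_zero _ z))
  exact ⟨m, n, hm, hn, by simpa using hfm.of_width_mul (k := 24) (by norm_num),
    by simpa using hfn.of_width_mul (k := 24) (by norm_num)⟩

end Cusps

lemma hasOrderAtImInfty_eta : HasOrderAtImInfty 24 (fun z => eta z) 1 := by
  simpa using hasOrderAtImInfty_eta_comp_mul one_pos

/-! ### The invariant quotient -/

section Quotient

variable {D : ℕ}

lemma exists_prod_eq_const (hD : D.Prime) (f : CuspForm (CongruenceSubgroup.Gamma1 D) 1)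
    (hf : f ∈ cuspFormsWithCharacter 1 D (fun d : ℤ => (kroneckerSymbol (-(D : ℤ)) d : ℂ)))
    (hne : ∀ z, f z ≠ 0) :
    ∃ m n : ℤ, 0 < m ∧ 0 < n ∧ (D : ℤ) + 1 = 12 * (m + n) ∧ ∃ c : ℂ, ∀ z : ℍ,
      f z ^ (12 * ((D : ℤ) - 1)) * eta z ^ (-(24 * ((D : ℤ) - 12 * m))) *
        eta (D * (z : ℂ)) ^ (-(24 * (12 * m - 1))) = c := by
  have hD0 : 0 < D := hD.pos
  have hDR : (0 : ℝ) < D := mod_cast hD0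
  have hDC : (D : ℂ) ≠ 0 := mod_cast hD.ne_zero
  obtain ⟨m, n, hm, hn, hfm, hfn⟩ := f.exists_orders hD0 hne
  -- These exponents solve two equations: weight zero, `M = 12(a + b)`, and order zero at `∞`, `mM =
  -- a + Db`.
  set M : ℤ := 12 * ((D : ℤ) - 1) with hM
  set a : ℤ := (D : ℤ) - 12 * m with ha
  set b : ℤ := 12 * m - 1 with hb
  set F : ℍ → ℂ := fun z => f z ^ M * eta z ^ (-(24 * a)) * eta (D * (z : ℂ)) ^ (-(24 * b)) with hF
  have hMab : M = 12 * a + 12 * b := by rw [hM, ha, hb]; ring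
  have hetaD : HasOrderAtImInfty 24 (fun z => eta (D * (z : ℂ))) D := by
    have := (hasOrderAtImInfty_eta_comp_mul hDR).of_width_mul hD.ne_zero
    rw [mul_div_cancel₀ _ hDR.ne'] at this
    simpa using this
  have heta0 : HasOrderAtImInfty (24 * D) (fun z => eta z) D := by
    simpa [mul_comm] using hasOrderAtImInfty_eta.of_width_mul hD.ne_zero
  have hetaD0 : HasOrderAtImInfty (24 * D) (fun z => eta ((1 / D : ℝ) * (z : ℂ))) 1 := by
    have := hasOrderAtImInfty_eta_comp_mul (t := 1 / D) (by positivity)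
    rwa [show (24 : ℝ) / (1 / D) = 24 * D by field_simp] at this
  have hηne (t : ℝ) (ht : 0 < t) (z : ℍ) : eta (t * (z : ℂ)) ≠ 0 :=
    eta_ne_zero (by simpa [upperHalfPlaneSet] using mul_pos ht z.im_pos)
  have hη1 (z : ℍ) : eta z ≠ 0 := eta_ne_zero z.im_pos
  have hηD (z : ℍ) : eta (D * (z : ℂ)) ≠ 0 := by simpa using hηne D hDR z
  have hFinfty : HasOrderAtImInfty 24 F 0 := by
    have := ((hfm.zpow M).mul (hasOrderAtImInfty_eta.zpow (-(24 * a)))).mul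
      (hetaD.zpow (-(24 * b)))
    convert this using 1
    rw [hM, ha, hb]
    ring
  have hFS (z : ℍ) : F (ModularGroup.S • z) = (D : ℂ) ^ (12 * b) *
      (((f : ℍ → ℂ) ∣[(1 : ℤ)] ModularGroup.S) z ^ M * eta z ^ (-(24 * a)) *
        eta ((1 / D : ℝ) * (z : ℂ)) ^ (-(24 * b))) := by
    have hz := z.ne_zero
    have hfS : f (ModularGroup.S • z) = ((f : ℍ → ℂ) ∣[(1 : ℤ)] ModularGroup.S) z * z := by
      rw [SL_slash_apply, ModularGroup.denom_S, zpow_neg_one, mul_assoc, inv_mul_cancel₀ hz,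
        mul_one]
    have h24 (x : ℂ) (j : ℤ) : x ^ (-(24 * j)) = (x ^ 24) ^ (-j) := by
      rw [← zpow_natCast, ← zpow_mul]; congr 1; push_cast; ring
    have h1 : eta ((ModularGroup.S • z : ℍ) : ℂ) ^ 24 = (z : ℂ) ^ (12 : ℤ) * eta z ^ 24 := by
      simpa [discriminant] using discriminant_smul ModularGroup.S z
    simp only [hF, h24, h1, eta_natCast_mul_S_smul_pow hD0, hfS, mul_zpow, div_zpow, ← zpow_mul]
    have hzpow : (z : ℂ) ^ M * (z : ℂ) ^ (12 * -a) * (z : ℂ) ^ (12 * -b) = 1 := by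
      rw [← zpow_add₀ hz, ← zpow_add₀ hz, hMab]
      simp
    have hDpow : ((D : ℂ) ^ (12 * -b))⁻¹ = (D : ℂ) ^ (12 * b) := by
      rw [← zpow_neg]; congr 1; ring
    rw [← hDpow, div_eq_mul_inv]
    linear_combination (((f : ℍ → ℂ) ∣[(1 : ℤ)] ModularGroup.S) z ^ M * (eta z ^ 24) ^ (-a) *
      (eta ((1 / D : ℝ) * (z : ℂ)) ^ 24) ^ (-b) * ((D : ℂ) ^ (12 * -b))⁻¹) * hzpow
  have hFzero : HasOrderAtImInfty (24 * D) (fun z => F (ModularGroup.S • z))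
      (24 * (n * M - D * a - b)) := by
    have := (HasOrderAtImInfty.const (zpow_ne_zero (12 * b) hDC)).mul
      (((hfn.zpow M).mul (heta0.zpow (-(24 * a)))).mul (hetaD0.zpow (-(24 * b))))
    convert this using 1
    · ext z; rw [hFS]
    · ring
  have hFne (z : ℍ) : F z ≠ 0 :=
    mul_ne_zero (mul_ne_zero (zpow_ne_zero _ (hne z)) (zpow_ne_zero _ (hη1 z)))
      (zpow_ne_zero _ (hηD z))
  have hFinv : ∀ γ ∈ CongruenceSubgroup.Gamma0 D, ∀ z : ℍ, F (γ • z) = F z := by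
    intro γ hγ z
    have hden : denom γ z ≠ 0 := denom_ne_zero _ z
    have hfγ := congrFun (hf γ hγ) z
    rw [SL_slash_apply, zpow_neg_one, ← div_eq_mul_inv, div_eq_iff hden] at hfγ
    -- A zero character value would make `f` vanish at `γ • z`.
    have hχ : kroneckerSymbol (-(D : ℤ)) (γ 1 1) ≠ 0 := by
      intro h0
      simp only [h0, Int.cast_zero, Pi.smul_apply, zero_smul, zero_mul] at hfγ
      exact hne _ hfγ
    have hχM : ((kroneckerSymbol (-(D : ℤ)) (γ 1 1) : ℤ) : ℂ) ^ M = 1 := by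
      have h2 : ((kroneckerSymbol (-(D : ℤ)) (γ 1 1) : ℤ) : ℂ) ^ (2 : ℤ) = 1 := by
        exact_mod_cast kroneckerSymbol_sq_of_ne_zero hχ
      rw [hM, show 12 * ((D : ℤ) - 1) = 2 * (6 * (D - 1)) by ring, zpow_mul, h2, one_zpow]
    have h24 (x : ℂ) (j : ℤ) : x ^ (-(24 * j)) = (x ^ 24) ^ (-j) := by
      rw [← zpow_natCast, ← zpow_mul]; congr 1; push_cast; ring
    have h1 : eta ((γ • z : ℍ) : ℂ) ^ 24 = denom γ z ^ (12 : ℤ) * eta z ^ 24 := by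
      simpa [discriminant] using discriminant_smul γ z
    simp only [hF, h24, h1, eta_natCast_mul_smul_pow hD0 hγ, hfγ, Pi.smul_apply, smul_eq_mul,
      mul_zpow, hχM, one_mul, ← zpow_mul]
    have hpow : denom γ z ^ M * denom γ z ^ (12 * -a) * denom γ z ^ (12 * -b) = 1 := by
      rw [← zpow_add₀ hden, ← zpow_add₀ hden, hMab]
      simp
    linear_combination (f z ^ M * (eta z ^ 24) ^ (-a) * (eta (D * (z : ℂ)) ^ 24) ^ (-b)) * hpow
  have hFhol : MDiff F := by
    have e1 : MDiff fun z : ℍ => eta z := by simpa using mdifferentiable_eta_mul one_pos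
    have e2 : MDiff fun z : ℍ => eta (D * (z : ℂ)) := by simpa using mdifferentiable_eta_mul hDR
    exact ((MDifferentiable.zpow_of_ne_zero f.holo' hne M).mul
      (MDifferentiable.zpow_of_ne_zero e1 hη1 _)).mul (MDifferentiable.zpow_of_ne_zero e2 hηD _)
  have h24D : (0 : ℝ) < 24 * D := by positivity
  obtain ⟨c, hc⟩ : ∃ c, ∀ z, F z = c := by
    -- The order of `F` at `0` is not yet known; according to its sign, `F` or `F⁻¹` is bounded
    -- there.
    rcases le_total 0 (24 * (n * M - D * a - b)) with hk | hk
    · exact exists_eq_const_of_Gamma0_invariant hD hFhol hFinv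
        (hFinfty.isBoundedAtImInfty (by norm_num) le_rfl) (hFzero.isBoundedAtImInfty h24D hk)
    · obtain ⟨c, hc⟩ := exists_eq_const_of_Gamma0_invariant hD
        (MDifferentiable.zpow_of_ne_zero hFhol hFne (-1)) (fun γ hγ z => by rw [hFinv γ hγ z])
        ((hFinfty.zpow (-1)).isBoundedAtImInfty (by norm_num) (by simp))
        ((hFzero.zpow (-1)).isBoundedAtImInfty h24D (by lia))
      exact ⟨c⁻¹, fun z => by rw [← hc z, zpow_neg_one, inv_inv]⟩
  refine ⟨m, n, hm, hn, ?_, c, hc⟩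
  simp only [hc] at hFzero
  have hk := hFzero.eq_zero_of_const h24D
  have hfactor : ((D : ℤ) - 1) * (12 * (m + n) - (D + 1)) = 0 := by
    rw [hM, ha, hb] at hk
    linarith
  have hD1 : (D : ℤ) - 1 ≠ 0 := by have := hD.two_le; lia
  have := (mul_eq_zero.mp hfactor).resolve_left hD1
  linarith

end Quotient

/-! ### Comparison of exponents and conclusion -/

theorem proposition6p1 (D : ℕ) (hD : D.Prime)
    (f : CuspForm (CongruenceSubgroup.Gamma1 D) 1)
    (hf : f ∈ cuspFormsWithCharacter 1 D (fun d : ℤ => (kroneckerSymbol (-(D : ℤ)) d : ℂ)))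
    (hη : IsEtaQuotient (f : ℍ → ℂ)) :
    D ≡ 23 [MOD 24] ∧
    (∀ z : ℍ, f z = ModularForm.eta (z : ℂ) * ModularForm.eta ((D : ℂ) * (z : ℂ))) ∧
    (∀ z : ℍ,
      Multipliable (fun n : ℕ+ =>
        (1 - Complex.exp (2 * Real.pi * Complex.I * z) ^ (n : ℕ)) ^
          (if D ∣ (n : ℕ) then 2 else 1 : ℕ)) ∧
      f z = Complex.exp (2 * Real.pi * Complex.I * z) ^ ((D + 1) / 24) *
        ∏' n : ℕ+, (1 - Complex.exp (2 * Real.pi * Complex.I * z) ^ (n : ℕ)) ^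
          (if D ∣ (n : ℕ) then 2 else 1 : ℕ)) := by
  obtain ⟨N, hN, r, hfr⟩ := hη
  have hηne {δ : ℕ} (hδ : δ ≠ 0) (z : ℍ) : eta ((δ : ℂ) * (z : ℂ)) ≠ 0 := by
    refine eta_ne_zero ?_
    have : (0 : ℝ) < δ := mod_cast Nat.pos_of_ne_zero hδ
    simpa [upperHalfPlaneSet] using mul_pos this z.im_pos
  have hne (z : ℍ) : f z ≠ 0 := by
    rw [hfr]
    exact Finset.prod_ne_zero_iff.mpr fun δ hδ =>
      zpow_ne_zero _ (hηne (Nat.pos_of_mem_divisors hδ).ne' z)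
  obtain ⟨m, n, hm, hn, hmn, c, hc⟩ := exists_prod_eq_const hD f hf hne
  set S : Finset ℕ := N.divisors ∪ {1, D} with hS
  have hNS : N.divisors ⊆ S := Finset.subset_union_left
  have h1S : 1 ∈ S := by simp [hS]
  have hDS : D ∈ S := by simp [hS]
  have h0S : 0 ∉ S := by simp [hS, hD.ne_zero.symm]
  have hxne (z : ℍ) : ∀ δ ∈ S, eta ((δ : ℂ) * (z : ℂ)) ≠ 0 := fun δ hδ =>
    hηne (fun h0 => h0S (h0 ▸ hδ)) z
  have hexp := eta_exponents_eq_zero h0S (c := c) fun z => by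
    rw [prod_zpow_sub_ite hNS h1S hDS (hxne z) r (12 * ((D : ℤ) - 1)) (24 * (D - 12 * m))
      (24 * (12 * m - 1)), ← hfr, ← hc z]
    simp
  have hD2 := hD.two_le
  have hD1 : D ≠ 1 := hD.ne_one
  have hr1 := hexp 1 h1S
  simp only [if_neg hD1.symm, if_true] at hr1
  set r' : ℕ → ℤ := fun δ => if δ ∈ N.divisors then r δ else 0
  -- Here `12n - 1 = D - 12m`. It is positive as `n ≥ 1` and less than `D - 1` as `m ≥ 1`, whence `0
  -- < r' 1 < 2`.
  have hr1' : r' 1 = 1 := by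
    have h : ((D : ℤ) - 1) * r' 1 = 2 * (12 * n - 1) := by linarith
    have hpos : 0 < r' 1 := pos_of_mul_pos_right (by rw [h]; lia) (by lia)
    have hlt : r' 1 < 2 := lt_of_mul_lt_mul_left (a := (D : ℤ) - 1) (by rw [h]; lia) (by lia)
    lia
  have hDm : (D : ℤ) + 1 = 24 * m := by
    have h : ((D : ℤ) - 1) * r' 1 = 2 * (12 * n - 1) := by linarith
    rw [hr1'] at h
    lia
  have hprod (z : ℍ) : f z = eta (z : ℂ) * eta ((D : ℂ) * (z : ℂ)) := by
    have hs : ∀ δ ∈ S, 1 * r' δ - (if δ = 1 then 1 else 0) - (if δ = D then 1 else 0) = 0 := by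
      intro δ hδ
      have h : 12 * ((D : ℤ) - 1) * r' δ - (if δ = 1 then 24 * ((D : ℤ) - 12 * m) else 0)
        - (if δ = D then 24 * (12 * m - 1) else 0) = 0 := hexp δ hδ
      refine (mul_eq_zero.mp (?_ : (12 * ((D : ℤ) - 1)) * _ = 0)).resolve_left (by lia)
      -- With `D + 1 = 24m` both eta exponents equal `12(D - 1)`, and this common factor cancels.
      have hcoef : 24 * ((D : ℤ) - 12 * m) = 12 * (D - 1) ∧
          24 * (12 * m - 1) = 12 * ((D : ℤ) - 1) :=
        ⟨by lia, by lia⟩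
      rw [hcoef.1, hcoef.2] at h
      split_ifs at h ⊢ <;> linear_combination h
    have h := prod_zpow_sub_ite hNS h1S hDS (hxne z) r 1 1 1
    rw [Finset.prod_congr rfl fun δ hδ => by rw [hs δ hδ], ← hfr] at h
    have e1 := hηne one_ne_zero z
    have e2 := hηne hD.ne_zero z
    simp only [Nat.cast_one, one_mul] at e1
    simp only [zpow_zero, Finset.prod_const_one, zpow_one, Nat.cast_one, one_mul, zpow_neg] at h
    field_simp at h
    exact h.symm
  refine ⟨?_, hprod, fun z => ?_⟩
  · rw [Nat.ModEq]
    lia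
  · have hq : ‖Complex.exp (2 * Real.pi * Complex.I * z)‖ < 1 := norm_exp_two_pi_I_lt_one z
    have h := hasProd_pnat_one_sub_pow_ite hq hD.pos
    refine ⟨h.multipliable, ?_⟩
    have hq1 : Periodic.qParam 1 (z : ℂ) = Complex.exp (2 * Real.pi * Complex.I * z) := by
      simp [Periodic.qParam]
    have hq24 : Periodic.qParam 24 (z : ℂ) ^ 24 = Complex.exp (2 * Real.pi * Complex.I * z) := by
      rw [Periodic.qParam, ← Complex.exp_nat_mul]
      congr 1
      push_cast
      field_simp
    have hpow : Complex.exp (2 * Real.pi * Complex.I * z) ^ ((D + 1) / 24) =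
        Periodic.qParam 24 (z : ℂ) * Periodic.qParam 24 (z : ℂ) ^ D := by
      rw [← hq24, ← pow_mul, Nat.mul_div_cancel' (by lia), pow_succ']
    have he1 := eta_natCast_mul 1 z
    simp only [Nat.cast_one, one_mul, pow_one] at he1
    rw [h.tprod_eq, hprod, eta_natCast_mul, he1, hq1, hpow]
    ring
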